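/- Let $\mathbb F$ be a field of characteristic zero with a map $|\cdot|:\mathbb F\to\mathbb R_{\ge 0}$ such that $|\lambda|=0$ iff $\lambda=0$, $|\lambda+\mu|\le|\lambda|+|\mu|$, $|-\lambda|=|\lambda|$, $|\lambda\mu|\le|\lambda|\,|\mu|$ and $|n\lambda|=n|\lambda|$ for all $\lambda,\mu\in\mathbb F$ and $n\in\mathbb N$. Let $\mathfrak A$ be an associative, not necessarily unital $\mathbb F$-algebra with a complete metric $\mathsf d$, and suppose that there is a real number $\gamma>0$ such that for all $a,b,c\in\mathfrak A$ and $\lambda\in\mathbb F$: 1. $\mathsf d(a+c,b+c)\le\gamma\,\mathsf d(a,b)$; 2. $\mathsf d(\lambda a,\lambda b)\le\gamma\,|\lambda|\,\mathsf d(a,b)$; 3. $\mathsf d(ac,bc)\le\gamma\,\mathsf d(c,0)\,\mathsf d(a,b)$ and $\mathsf d(ca,cb)\le\gamma\,\mathsf d(c,0)\,\mathsf d(a,b)$. Then Köthe's Problem has an affirmative answer for $\mathfrak A$: if $\mathfrak A$ has no nonzero nil two-sided ideals, then $\mathfrak A$ has no nonzero nil left ideals and no nonzero nil right ideals. This holds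 both when "ideal" means an ideal of the underlying ring of $\mathfrak A$ and when it means an ideal of the $\mathbb F$-algebra $\mathfrak A$, that is, an ideal which is an $\mathbb F$-subspace. (An ideal is nil if each of its elements $a$ satisfies $a^n=0$ for some $n\ge 1$.) -/

import Mathlib

namespace MetricKothe

/-- The normed-field condition on a map `ν : F → ℝ` in characteristic zero: `ν` is a norm on the
additive group of `F` with `ν (-x) = ν x` and `ν (x * y) ≤ ν x * ν y` (this is what the bundled
`RingNorm F` records; `ν` is only submultiplicative and `ν 1 = 1` is not required), and moreover
`ν (n • x) = n * ν x` for all natural numbers `n`. -/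
def IsCharZeroFieldNorm {F : Type*} [Field F] (ν : RingNorm F) : Prop :=
  ∀ (n : ℕ) (x : F), ν (n • x) = n * ν x

/-- `A`, an associative (not necessarily unital) algebra over the normed field `(F, ν)` with a
metric, is a metric `F`-algebra. -/
def IsMetricAlgebra {F : Type*} [Field F] (ν : RingNorm F) (A : Type*) [NonUnitalRing A]
    [Module F A] [MetricSpace A] : Prop :=
  ∃ γ : ℝ, 0 < γ ∧
    (∀ a b c : A, dist (a + c) (b + c) ≤ γ * dist a b) ∧
    (∀ (l : F) (a b : A), dist (l • a) (l • b) ≤ γ * ν l * dist a b) ∧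
    (∀ a b c : A, dist (a * c) (b * c) ≤ γ * dist c 0 * dist a b ∧
      dist (c * a) (c * b) ≤ γ * dist c 0 * dist a b)

/-- `powSucc a n` is the power `a ^ (n + 1)`, which makes sense without a unit. -/
def powSucc {R : Type*} [Mul R] (a : R) : ℕ → R
  | 0 => a
  | n + 1 => powSucc a n * a

/-- Some power of `a` with positive exponent vanishes. -/
def IsNilElement {R : Type*} [NonUnitalRing R] (a : R) : Prop :=
  ∃ n : ℕ, powSucc a n = 0

/-- The additive subgroup `I` is nil: each of its elements is nilpotent. -/
def IsNil {R : Type*} [NonUnitalRing R] (I : AddSubgroup R) : Prop :=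
  ∀ a ∈ I, IsNilElement a

/-- `I` is a left ideal of the ring `R`. -/
def IsLeftIdeal {R : Type*} [NonUnitalRing R] (I : AddSubgroup R) : Prop :=
  ∀ x : R, ∀ a ∈ I, x * a ∈ I

/-- `I` is a right ideal of the ring `R`. -/
def IsRightIdeal {R : Type*} [NonUnitalRing R] (I : AddSubgroup R) : Prop :=
  ∀ x : R, ∀ a ∈ I, a * x ∈ I

/-- Köthe's Problem has an affirmative answer for the ring `R`: if `R` has no nonzero nil
(two-sided) ideals, then `R` has no nonzero nil one-sided ideals. -/
def KotheAffirmative (R : Type*) [NonUnitalRing R] : Prop :=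
  (∀ I : AddSubgroup R, IsLeftIdeal I → IsRightIdeal I → IsNil I → I = ⊥) →
    ∀ I : AddSubgroup R, IsLeftIdeal I ∨ IsRightIdeal I → IsNil I → I = ⊥

/-- Köthe's Problem has an affirmative answer for the `F`-algebra `A`: the same implication with
ideals of the algebra, that is, ideals which are `F`-subspaces. -/
def KotheAffirmativeAlgebra (F A : Type*) [Field F] [NonUnitalRing A] [Module F A] : Prop :=
  (∀ I : Submodule F A, IsLeftIdeal I.toAddSubgroup → IsRightIdeal I.toAddSubgroup →
      IsNil I.toAddSubgroup → I = ⊥) →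
    ∀ I : Submodule F A, IsLeftIdeal I.toAddSubgroup ∨ IsRightIdeal I.toAddSubgroup →
      IsNil I.toAddSubgroup → I = ⊥

end MetricKothe

namespace MetricKothe

open Filter Topology

section Powers

variable {R : Type*} [NonUnitalRing R]

/-! Let `a` lie in a nil one-sided ideal. Then every `x * a` is nilpotent; for a right ideal this
follows from the nilpotency of `a * x`. Multiplication is continuous, so `A` is a countable union of
closed sets on which the nilpotency index of `x * a` is bounded, and by Baire one of them contains a
ball. Along a line through its centre in direction `y`, a power of `(x + t • y) * a` is a polynomial
in `t` with infinitely many zeros, so its top coefficient, a power of `y * a`, vanishes: the index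
is bounded for all `y`. Absence of nil ideals makes `A` semiprime, and Levitzki's theorem gives `a =
0`. -/

theorem powSucc_mul_powSucc (u : R) (i j : ℕ) :
    powSucc u i * powSucc u j = powSucc u (i + j + 1) := by
  induction j with
  | zero => rfl
  | succ j ih =>
    change powSucc u i * (powSucc u j * u) = powSucc u (i + j + 1) * u
    rw [← mul_assoc, ih]

theorem mul_powSucc_eq_zero_of_le {b u : R} {i j : ℕ} (h : b * powSucc u i = 0) (hij : i ≤ j) :
    b * powSucc u j = 0 := by
  induction j, hij using Nat.le_induction with
  | base => exact h
  | succ j _ ih =>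
    change b * (powSucc u j * u) = 0
    rw [← mul_assoc, ih, zero_mul]

theorem exists_powSucc_mul_eq (x b : R) (k : ℕ) : ∃ y, powSucc (x * b) k = y * b := by
  cases k with
  | zero => exact ⟨x, rfl⟩
  | succ k => exact ⟨powSucc (x * b) k * x, (mul_assoc _ _ _).symm⟩

theorem powSucc_swap (x a : R) (n : ℕ) :
    powSucc (x * a) (n + 1) = x * powSucc (a * x) n * a := by
  induction n with
  | zero => simp only [powSucc, mul_assoc]
  | succ n ih =>
    change powSucc (x * a) (n + 1) * (x * a) = x * (powSucc (a * x) n * (a * x)) * a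
    rw [ih]
    simp only [mul_assoc]

theorem IsNilElement.swap {a x : R} (h : IsNilElement (a * x)) : IsNilElement (x * a) := by
  obtain ⟨n, hn⟩ := h
  exact ⟨n + 1, by rw [powSucc_swap, hn, mul_zero, zero_mul]⟩

/-- **Levitzki's theorem** for a semiprime ring, in elementwise form. -/
theorem eq_zero_of_forall_mul_powSucc_eq_zero
    (hR : ∀ b : R, (∀ x, b * (x * b) = 0) → b = 0) (k : ℕ) :
    ∀ b : R, (∀ x, b * powSucc (x * b) k = 0) → b = 0 := by
  induction k with
  | zero => exact hR
  | succ k ih =>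
    intro b hb
    -- The induction hypothesis is used twice: for `b`, and then to kill each `f = b * powSucc (x₀ *
    -- b) k`.
    refine ih b fun x₀ => ih _ fun x => ?_
    obtain ⟨y, hy⟩ := exists_powSucc_mul_eq x₀ b k
    set e := powSucc (x₀ * b) k with he
    have hfe : b * e * e = 0 := by
      rw [mul_assoc, he, powSucc_mul_powSucc]
      exact mul_powSucc_eq_zero_of_le (hb x₀) (by omega)
    set f := b * e with hf
    have hend : ∀ j, powSucc (x * f) j * e = 0 := by
      intro j
      obtain ⟨z, hz⟩ := exists_powSucc_mul_eq x f j
      rw [hz, mul_assoc, hfe, mul_zero]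
    -- Since `f * e = 0`, a surviving word has all its `e` in front; since `b * e * e = 0`, it has
    -- at most one.
    have hexp : ∀ j, b * powSucc (x * f + e) (j + 1) =
        b * powSucc (x * f) (j + 1) + f * powSucc (x * f) j := by
      intro j
      induction j with
      | zero =>
        change b * ((x * f + e) * (x * f + e)) = b * (x * f * (x * f)) + f * (x * f)
        have h0 : x * f * e = 0 := hend 0
        rw [← mul_assoc, mul_add b, ← hf, mul_add, add_mul, add_mul, hfe, mul_assoc b (x * f) e,
          h0, mul_zero, add_zero, add_zero, mul_assoc b]
      | succ j ihj =>
        change b * (powSucc (x * f + e) (j + 1) * (x * f + e)) =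
          b * (powSucc (x * f) (j + 1) * (x * f)) + f * (powSucc (x * f) j * (x * f))
        rw [← mul_assoc, ihj, mul_add, add_mul, add_mul, mul_assoc b _ e, hend, mul_assoc f _ e,
          hend, mul_zero, mul_zero, add_zero, add_zero, mul_assoc, mul_assoc f]
    -- Both `x * f + e` and `x * f` are left multiples of `b`, so `hb` removes two of the three
    -- terms of `hexp k`.
    have h1 : x * f + e = (x * b * y + y) * b := by
      rw [hf, hy, add_mul]; simp only [mul_assoc]
    have h2 : x * f = x * b * y * b := by rw [hf, hy]; simp only [mul_assoc]
    have h3 := hexp k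
    rw [h1, hb] at h3
    nth_rewrite 1 [h2] at h3
    rw [hb, zero_add] at h3
    exact h3.symm

end Powers

section Semiprime

variable {F A : Type*} [Field F] [NonUnitalRing A] [Module F A] [IsScalarTower F A A]
  [SMulCommClass F A A]

theorem isNilElement_of_mul_self_eq_zero {a : A} (h : a * a = 0) : IsNilElement a := ⟨1, h⟩

/-- An algebra without nonzero nil algebra ideals is semiprime, in elementwise form. -/
theorem eq_zero_of_forall_mul_mul_eq_zero
    (hA : ∀ I : Submodule F A, IsLeftIdeal I.toAddSubgroup → IsRightIdeal I.toAddSubgroup →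
      IsNil I.toAddSubgroup → I = ⊥)
    (b : A) (hb : ∀ x, b * (x * b) = 0) : b = 0 := by
  -- Without a unit, `r * b * s = 0` for all `r`, `s` does not give `b = 0` at once. The two
  -- annihilators of `A` are square-zero ideals, hence zero, which strips off `s` and `r`.
  have hleft : ∀ a : A, (∀ x, x * a = 0) → a = 0 := by
    intro a ha
    let N : Submodule F A :=
      { carrier := {a | ∀ x, x * a = 0}
        zero_mem' := fun x => mul_zero x
        add_mem' := fun {a c} ha hc x => by rw [mul_add, ha x, hc x, add_zero]
        smul_mem' := fun l a ha x => by rw [mul_smul_comm, ha x, smul_zero] }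
    have hN : N = ⊥ := hA N (fun x a ha y => by rw [← mul_assoc]; exact ha _)
      (fun x a ha y => by rw [← mul_assoc, ha y, zero_mul])
      (fun a ha => isNilElement_of_mul_self_eq_zero (ha a))
    have : a ∈ N := ha
    rwa [hN, Submodule.mem_bot] at this
  have hright : ∀ a : A, (∀ x, a * x = 0) → a = 0 := by
    intro a ha
    let N : Submodule F A :=
      { carrier := {a | ∀ x, a * x = 0}
        zero_mem' := fun x => zero_mul x
        add_mem' := fun {a c} ha hc x => by rw [add_mul, ha x, hc x, add_zero]
        smul_mem' := fun l a ha x => by rw [smul_mul_assoc, ha x, smul_zero] }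
    have hN : N = ⊥ := hA N (fun x a ha y => by rw [mul_assoc, ha y, mul_zero])
      (fun x a ha y => by rw [mul_assoc]; exact ha _)
      (fun a ha => isNilElement_of_mul_self_eq_zero (ha a))
    have : a ∈ N := ha
    rwa [hN, Submodule.mem_bot] at this
  let J : Submodule F A := Submodule.span F {c | ∃ r s, c = r * b * s}
  have hJJ : ∀ x ∈ J, ∀ y ∈ J, x * y = 0 := by
    intro x hx y hy
    induction hx, hy using Submodule.span_induction₂ with
    | mem_mem x y hx hy =>
      obtain ⟨r, s, rfl⟩ := hx
      obtain ⟨r', s', rfl⟩ := hy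
      have : r * b * s * (r' * b * s') = r * (b * (s * r' * b)) * s' := by simp only [mul_assoc]
      rw [this, hb, mul_zero, zero_mul]
    | zero_left y hy => exact zero_mul y
    | zero_right x hx => exact mul_zero x
    | add_left x y z _ _ _ h1 h2 => rw [add_mul, h1, h2, add_zero]
    | add_right x y z _ _ _ h1 h2 => rw [mul_add, h1, h2, add_zero]
    | smul_left r x y _ _ h => rw [smul_mul_assoc, h, smul_zero]
    | smul_right r x y _ _ h => rw [mul_smul_comm, h, smul_zero]
  have hJ : J = ⊥ := by
    refine hA J (fun x a ha => ?_) (fun x a ha => ?_)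
      (fun a ha => isNilElement_of_mul_self_eq_zero (hJJ a ha a ha))
    · change x * a ∈ J
      induction ha using Submodule.span_induction with
      | mem a ha =>
        obtain ⟨r, s, rfl⟩ := ha
        exact Submodule.subset_span ⟨x * r, s, by simp only [mul_assoc]⟩
      | zero => rw [mul_zero]; exact J.zero_mem
      | add a c _ _ h1 h2 => rw [mul_add]; exact J.add_mem h1 h2
      | smul l a _ h => rw [mul_smul_comm]; exact J.smul_mem l h
    · change a * x ∈ J
      induction ha using Submodule.span_induction with
      | mem a ha =>
        obtain ⟨r, s, rfl⟩ := ha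
        exact Submodule.subset_span ⟨r, s * x, by simp only [mul_assoc]⟩
      | zero => rw [zero_mul]; exact J.zero_mem
      | add a c _ _ h1 h2 => rw [add_mul]; exact J.add_mem h1 h2
      | smul l a _ h => rw [smul_mul_assoc]; exact J.smul_mem l h
  refine hleft b fun r => hright _ fun s => ?_
  have : r * b * s ∈ J := Submodule.subset_span ⟨r, s, rfl⟩
  rwa [hJ, Submodule.mem_bot] at this

end Semiprime

section Polynomial

variable {F A : Type*} [Field F] [NonUnitalRing A] [Module F A]

/-- A polynomial with coefficients in a vector space and infinitely many zeros in the field has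
vanishing coefficients. -/
theorem coeff_eq_zero_of_infinite_zeros {V : Type*} [AddCommGroup V] [Module F V] {n : ℕ}
    {c : ℕ → V} {T : Set F} (hT : T.Infinite)
    (h : ∀ t ∈ T, ∑ i ∈ Finset.range n, t ^ i • c i = 0) {j : ℕ} (hj : j < n) : c j = 0 := by
  -- Linear functionals reduce the claim to scalar polynomials.
  rw [← Module.forall_dual_apply_eq_zero_iff F]
  intro φ
  let p : Polynomial F := ∑ i ∈ Finset.range n, Polynomial.monomial i (φ (c i))
  have hp : p = 0 := by
    refine Polynomial.eq_zero_of_infinite_isRoot p (hT.mono fun t ht => ?_)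
    have := congrArg φ (h t ht)
    simp only [map_sum, map_smul, map_zero, smul_eq_mul] at this
    simpa [p, Polynomial.eval_finsetSum, mul_comm] using this
  have := congrArg (fun q => Polynomial.coeff q j) hp
  simpa [p, Polynomial.finsetSum_coeff, Polynomial.coeff_monomial, hj] using this

variable [IsScalarTower F A A] [SMulCommClass F A A]

/-- `c i` collects the words in `u`, `v` with `i` factors `v`; only the top one matters later, as it
is free of `u`. -/
theorem exists_powSucc_add_smul_eq_sum (u v : A) (n : ℕ) :
    ∃ c : ℕ → A, c (n + 1) = powSucc v n ∧
      ∀ t : F, powSucc (u + t • v) n = ∑ i ∈ Finset.range (n + 2), t ^ i • c i := by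
  induction n with
  | zero =>
    refine ⟨fun i => if i = 0 then u else v, by simp [powSucc], fun t => ?_⟩
    simp [Finset.sum_range_succ, powSucc]
  | succ n ih =>
    obtain ⟨c, hc, h⟩ := ih
    refine ⟨fun i => (if i < n + 2 then c i * u else 0) + (if i = 0 then 0 else c (i - 1) * v),
      by simp [powSucc, hc], fun t => ?_⟩
    simp only [smul_add, Finset.sum_add_distrib]
    rw [powSucc, h, mul_add, Finset.sum_mul, Finset.sum_mul]
    congr 1
    · rw [Finset.sum_range_succ _ (n + 2)]
      simp only [lt_irrefl, if_false, smul_zero, add_zero]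
      refine Finset.sum_congr rfl fun i hi => ?_
      rw [if_pos (Finset.mem_range.1 hi), smul_mul_assoc]
    · rw [Finset.sum_range_succ' _ (n + 2)]
      simp only [if_true, smul_zero, add_zero, Nat.add_sub_cancel, Nat.succ_ne_zero, if_false]
      refine Finset.sum_congr rfl fun i _ => ?_
      rw [smul_mul_assoc, mul_smul_comm, smul_smul, pow_succ]

end Polynomial

section Metric

variable {F A : Type*} [Field F] {ν : RingNorm F} [NonUnitalRing A] [Module F A] [MetricSpace A]

theorem IsMetricAlgebra.continuousAdd (hA : IsMetricAlgebra ν A) : ContinuousAdd A := by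
  obtain ⟨γ, -, hadd, -, -⟩ := hA
  refine ⟨continuous_iff_continuousAt.2 fun p => ?_⟩
  rw [ContinuousAt, tendsto_iff_dist_tendsto_zero]
  have hlim : Tendsto (fun q : A × A => γ * dist q.1 p.1 + γ * dist q.2 p.2) (𝓝 p) (𝓝 0) := by
    have : Continuous fun q : A × A => γ * dist q.1 p.1 + γ * dist q.2 p.2 := by fun_prop
    simpa using this.tendsto p
  refine squeeze_zero (fun _ => dist_nonneg) (fun q => ?_) hlim
  refine (dist_triangle _ (p.1 + q.2) _).trans (add_le_add (hadd _ _ _) ?_)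
  rw [add_comm p.1, add_comm p.1]
  exact hadd _ _ _

theorem IsMetricAlgebra.continuousMul (hA : IsMetricAlgebra ν A) : ContinuousMul A := by
  obtain ⟨γ, -, -, -, hmul⟩ := hA
  refine ⟨continuous_iff_continuousAt.2 fun p => ?_⟩
  rw [ContinuousAt, tendsto_iff_dist_tendsto_zero]
  have hlim : Tendsto (fun q : A × A => γ * dist q.2 0 * dist q.1 p.1 +
      γ * dist p.1 0 * dist q.2 p.2) (𝓝 p) (𝓝 0) := by
    have : Continuous fun q : A × A => γ * dist q.2 0 * dist q.1 p.1 +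
      γ * dist p.1 0 * dist q.2 p.2 := by fun_prop
    simpa using this.tendsto p
  refine squeeze_zero (fun _ => dist_nonneg) (fun q => ?_) hlim
  exact (dist_triangle _ (p.1 * q.2) _).trans (add_le_add (hmul _ _ _).1 (hmul _ _ _).2)

theorem IsCharZeroFieldNorm.tendsto_inv_natCast [CharZero F] (hν : IsCharZeroFieldNorm ν) :
    Tendsto (fun m : ℕ => ν ((m + 1 : ℕ) : F)⁻¹) atTop (𝓝 0) := by
  have h : ∀ m : ℕ, ν ((m + 1 : ℕ) : F)⁻¹ = ν 1 * (1 / ((m : ℝ) + 1)) := by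
    intro m
    -- As `ν` is only submultiplicative, the inverse is evaluated through `(m + 1) • (m + 1)⁻¹ = 1`.
    have h1 := hν (m + 1) ((m + 1 : ℕ) : F)⁻¹
    rw [nsmul_eq_mul, mul_inv_cancel₀ (Nat.cast_ne_zero.2 m.succ_ne_zero)] at h1
    rw [h1]
    push_cast
    have : (m : ℝ) + 1 ≠ 0 := by positivity
    field_simp
  simp only [h]
  simpa using tendsto_one_div_add_atTop_nhds_zero_nat.const_mul (ν 1)

theorem IsMetricAlgebra.tendsto_smul (hA : IsMetricAlgebra ν A) {ι : Type*} {l : Filter ι}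
    {t : ι → F} (ht : Tendsto (fun i => ν (t i)) l (𝓝 0)) (y : A) :
    Tendsto (fun i => t i • y) l (𝓝 0) := by
  obtain ⟨γ, -, -, hsmul, -⟩ := hA
  rw [tendsto_iff_dist_tendsto_zero]
  refine squeeze_zero (fun _ => dist_nonneg)
    (fun i => by simpa using hsmul (t i) y 0) ?_
  simpa using (ht.const_mul γ).mul_const (dist y 0)

theorem continuous_powSucc [ContinuousMul A] (n : ℕ) : Continuous fun a : A => powSucc a n := by
  induction n with
  | zero => exact continuous_id
  | succ n ih => exact ih.mul continuous_id

/-- By Baire's theorem, if every left multiple of `a` is nilpotent, then the index of nilpotency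
is bounded. -/
theorem IsMetricAlgebra.exists_forall_powSucc_eq_zero [CharZero F] (hν : IsCharZeroFieldNorm ν)
    [IsScalarTower F A A] [SMulCommClass F A A] [CompleteSpace A] (hA : IsMetricAlgebra ν A)
    {a : A} (ha : ∀ x, IsNilElement (x * a)) : ∃ n, ∀ y, powSucc (y * a) n = 0 := by
  have := hA.continuousAdd
  have := hA.continuousMul
  let C : ℕ → Set A := fun n => {x | powSucc (x * a) n = 0}
  have hC : ∀ n, IsClosed (C n) := fun n =>
    isClosed_eq ((continuous_powSucc n).comp (continuous_id.mul continuous_const))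
      continuous_const
  have hU : ⋃ n, C n = Set.univ := Set.eq_univ_of_forall fun x => Set.mem_iUnion.2 (ha x)
  obtain ⟨n, x, hx⟩ := nonempty_interior_of_iUnion_of_closed hC hU
  refine ⟨n, fun y => ?_⟩
  have hlim : Tendsto (fun m : ℕ => x + ((m + 1 : ℕ) : F)⁻¹ • y) atTop (𝓝 x) := by
    simpa using (hA.tendsto_smul hν.tendsto_inv_natCast y).const_add x
  obtain ⟨M, hM⟩ := eventually_atTop.1 (hlim.eventually (mem_interior_iff_mem_nhds.1 hx))
  obtain ⟨c, hc, h⟩ := exists_powSucc_add_smul_eq_sum (F := F) (x * a) (y * a) n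
  rw [← hc]
  have hinj : Function.Injective fun m : ℕ => ((m + 1 : ℕ) : F)⁻¹ := fun m m' hm => by
    simpa using hm
  refine coeff_eq_zero_of_infinite_zeros
    ((Set.Ici_infinite M).image hinj.injOn) ?_ (Nat.lt_succ_self (n + 1))
  rintro _ ⟨m, hm, rfl⟩
  rw [← h, ← smul_mul_assoc, ← add_mul]
  exact hM m hm

end Metric

end MetricKothe

open MetricKothe in
-- Serves both notions of ideal: the hypothesis on subspace ideals is the weaker one, and the
-- conclusion concerns single elements.
theorem MetricKothe.IsMetricAlgebra.eq_zero_of_forall_isNilElement_mul {F : Type*} [Field F]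
    [CharZero F] {ν : RingNorm F} (hν : IsCharZeroFieldNorm ν) {A : Type*} [NonUnitalRing A]
    [Module F A] [IsScalarTower F A A] [SMulCommClass F A A] [MetricSpace A] [CompleteSpace A]
    (hA : IsMetricAlgebra ν A)
    (hnil : ∀ I : Submodule F A, IsLeftIdeal I.toAddSubgroup → IsRightIdeal I.toAddSubgroup →
      IsNil I.toAddSubgroup → I = ⊥)
    {a : A} (ha : ∀ x, IsNilElement (x * a)) : a = 0 := by
  obtain ⟨n, hn⟩ := hA.exists_forall_powSucc_eq_zero hν ha
  exact eq_zero_of_forall_mul_powSucc_eq_zero (eq_zero_of_forall_mul_mul_eq_zero hnil) n a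
    fun x => by rw [hn, mul_zero]

theorem MetricKothe.isNilElement_mul_of_mem {R : Type*} [NonUnitalRing R] {I : AddSubgroup R}
    (hI : IsLeftIdeal I ∨ IsRightIdeal I) (hnil : IsNil I) {a : R} (ha : a ∈ I) (x : R) :
    IsNilElement (x * a) :=
  hI.elim (fun h => hnil _ (h x a ha)) fun h => (hnil _ (h x a ha)).swap

theorem corollary2p7 {F : Type*} [Field F] [CharZero F] (ν : RingNorm F)
    (hν : MetricKothe.IsCharZeroFieldNorm ν)
    {A : Type*} [NonUnitalRing A] [Module F A] [IsScalarTower F A A] [SMulCommClass F A A]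
    [MetricSpace A] [CompleteSpace A] (hA : MetricKothe.IsMetricAlgebra ν A) :
    MetricKothe.KotheAffirmative A ∧ MetricKothe.KotheAffirmativeAlgebra F A := by
  refine ⟨fun hnil I hI hIn => ?_, fun hnil I hI hIn => ?_⟩
  · refine (AddSubgroup.eq_bot_iff_forall I).2 fun a ha =>
      hA.eq_zero_of_forall_isNilElement_mul hν (fun J hl hr hJ => ?_)
        (MetricKothe.isNilElement_mul_of_mem hI hIn ha)
    exact Submodule.toAddSubgroup_injective (by rw [hnil _ hl hr hJ]; rfl)
  · exact (Submodule.eq_bot_iff I).2 fun a ha =>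
      hA.eq_zero_of_forall_isNilElement_mul hν hnil
        (MetricKothe.isNilElement_mul_of_mem hI hIn ha)
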